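/- Let $G=(V,E)$ be a finite acyclic directed multigraph (parallel channels allowed, all channels of unit capacity) with a single source $s$ that has no incoming channels and a set $T\subseteq V\setminus\{s\}$ of sinks that have no outgoing channels; nodes in $V\setminus(\{s\}\cup T)$ are called internal. For a channel $e$ from node $i$ to node $j$ write $\mathrm{tail}(e)=i$, $\mathrm{head}(e)=j$; $In(v)$ and $Out(v)$ are the sets of channels with head $v$ and with tail $v$. For $t\in T$ let $C_t$ be the minimum number of channels whose removal disconnects $t$ from $s$. Let $\mathbb F$ be a field. An $n$-dimensional $\mathbb F$-valued linear network error correction code on $G$ consists of a local encoding kernel at each non-sink node: at $s$ a matrix $(k_{d_i',e})$, $1\le i\le n$, $e\in Out(s)$, where $d_1',\dots,d_n'$ are imaginary message channels entering $s$, and at each internal node $v$ a matrix $(k_{d,e})$, $d\in In(v)$, $e\in Out(v)$, with entries in $\mathbb F$. Its extended global encoding kernels $\tilde f_e\in\mathbb F^{n+|E|}$, $e\in E$, with coordinates indexed by $\{d_1',\dots,d_n'\}\cup E$, are defined recursively by $$\tilde f_e=\sum_{d}k_{d,e}\tilde f_d+1_e,\qquad \tilde f_{d_i'}=1_{d_i'},$$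 where $1_x$ is the unit vector at coordinate $x$ and $d$ runs over $In(\mathrm{tail}(e))$, or over $d_1',\dots,d_n'$ if $\mathrm{tail}(e)=s$. For $t\in T$ let $F_t$ ($n\times|In(t)|$) and $G_t$ ($|E|\times|In(t)|$) be the upper and lower blocks of the matrix with columns $\tilde f_e$, $e\in In(t)$. The message space is $\Phi(t)=\{XF_t: X\in\mathbb F^n\}$, and the error space of an error pattern $\rho\subseteq E$ is $\Delta(t,\rho)=\{ZG_t: Z\in\mathbb F^{E},\ Z_e=0\text{ for all }e\notin\rho\}$. The pattern $\rho$ is dominated by $\rho'$ with respect to $t$ if $\Delta(t,\rho)\subseteq\Delta(t,\rho')$ for every $\mathbb F$-valued linear network code on $G$, and $rank_t(\rho)$ is the minimum of $|\rho'|$ over all $\rho'$ that dominate $\rho$. The code is regular if $\dim\Phi(t)=n$ for all $t\in T$; its minimum distance at $t$ is $d^{(t)}_{\min}=\min\{rank_t(\rho):\dim(\Delta(t,\rho)\cap\Phi(t))>0\}$. A network MDS code is a regular code with $d_{\min}^{(t)}=C_t-n+1$ for all $t\in T$. **Corollary.** Let $\omega$ be a positive integer with $\omega\le C_t$ for all $t\in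 T$. If $$|\mathbb F|>\max_{1\le i\le\omega}\ \sum_{t\in T}\binom{|E|}{C_t-i},$$ then there is a family of variable-rate $\mathbb F$-valued network MDS codes of dimensions $1,2,\dots,\omega$ on $G$, that is, for each $n\in\{1,\dots,\omega\}$ an $n$-dimensional $\mathbb F$-valued network MDS code, such that all these codes have the same local encoding kernel at each internal node. -/

import Mathlib

/-- A single-source multicast network: a finite acyclic directed multigraph with node type `V` and
channel type `E` (parallel channels are allowed, every channel has unit capacity), a source without
incoming channels, and a set of sinks, none of which has outgoing channels. -/
structure Network (V E : Type*) where
  tail : E → V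
  head : E → V
  source : V
  sinks : Finset V
  acyclic : ∀ v : V, ¬ Relation.TransGen (fun u w : V => ∃ e : E, tail e = u ∧ head e = w) v v
  source_notMem_sinks : source ∉ sinks
  head_ne_source : ∀ e : E, head e ≠ source
  tail_notMem_sinks : ∀ e : E, tail e ∉ sinks

namespace Network

variable {V E : Type*}

/-- The incoming (real) channels of a node. -/
abbrev In (G : Network V E) (v : V) : Type _ := {e : E // G.head e = v}

/-- The outgoing channels of a node. -/
abbrev Out (G : Network V E) (v : V) : Type _ := {e : E // G.tail e = v}

/-- The internal nodes are the nodes that are neither the source nor a sink. -/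
def IsInternal (G : Network V E) (v : V) : Prop := v ≠ G.source ∧ v ∉ G.sinks

/-- A set `A` of channels is a cut between `u` and `v` if no directed path from `u` to `v` is left
after the channels in `A` have been removed. -/
def IsCut (G : Network V E) (A : Finset E) (u v : V) : Prop :=
  ¬ Relation.ReflTransGen (fun x y : V => ∃ e : E, e ∉ A ∧ G.tail e = x ∧ G.head e = y) u v

/-- The minimum cut capacity `C_t` between the source and the node `t`. -/
noncomputable def minCut (G : Network V E) (t : V) : ℕ :=
  sInf {n : ℕ | ∃ A : Finset E, G.IsCut A G.source t ∧ A.card = n}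

/-- In a finite acyclic network the relation "`d` enters the node that `e` leaves" is well-founded;
this is the upstream-to-downstream order along which the encoding kernels are computed. -/
theorem wellFounded_adj [Finite E] (G : Network V E) :
    WellFounded (fun d e : E => G.head d = G.tail e) := by
  have key : ∀ d e : E, Relation.TransGen (fun d e : E => G.head d = G.tail e) d e →
      Relation.TransGen (fun u w : V => ∃ e : E, G.tail e = u ∧ G.head e = w)
        (G.tail d) (G.tail e) := by
    intro d e h
    induction h with
    | single h => exact Relation.TransGen.single ⟨d, rfl, h⟩
    | @tail b c _ hbc ih => exact Relation.TransGen.tail ih ⟨b, rfl, hbc⟩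
  have hirr : Std.Irrefl (Relation.TransGen (fun d e : E => G.head d = G.tail e)) :=
    ⟨fun e h => G.acyclic _ (key e e h)⟩
  have hwf : WellFounded (Relation.TransGen (fun d e : E => G.head d = G.tail e)) :=
    Finite.wellFounded_of_trans_of_irrefl _
  exact Subrelation.wf
    (r := Relation.TransGen (fun d e : E => G.head d = G.tail e))
    (fun {_ _} h => Relation.TransGen.single h) hwf

end Network

/-- An `n`-dimensional `F`-valued linear network error correction code on `G`, in its local
description: an `n × |Out(s)|` local encoding kernel at the source `s`, whose rows belong to the
`n` imaginary message channels, and an `|In(v)| × |Out(v)|` local encoding kernel at every other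
node `v`.
At `v = s` (no real incoming channels) and at the sinks (no outgoing channels) the matrix
`kernel v` has no entries, so `kernel` holds exactly the kernels at the internal nodes. -/
structure NetworkCode {V E : Type*} (G : Network V E) (F : Type*) (n : ℕ) where
  sourceKernel : Matrix (Fin n) (G.Out G.source) F
  kernel : ∀ v : V, Matrix (G.In v) (G.Out v) F

namespace NetworkCode

variable {V E F : Type*} [DecidableEq V] [Fintype E] [DecidableEq E] [Field F]
  {G : Network V E} {n : ℕ}

/-- The extended global encoding kernel of a channel `e`: the vector, with entries indexed by the
`n` imaginary message channels and by the channels in `E`, that is determined by the recursion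
`f_e = ∑_{d ∈ In(tail(e))} k_{d,e} f_d + 1_e`. If `tail(e)` is the source, then the sum is over the
imaginary message channels, whose kernels are the unit vectors. -/
noncomputable def extKernel (C : NetworkCode G F n) : E → (Fin n ⊕ E → F) :=
  G.wellFounded_adj.fix fun e f =>
    (if h : G.tail e = G.source then
        ∑ i : Fin n, C.sourceKernel i ⟨e, h⟩ • Pi.single (Sum.inl i) (1 : F)
      else
        ∑ d : G.In (G.tail e), C.kernel (G.tail e) d ⟨e, rfl⟩ • f d.1 d.2)
    + Pi.single (Sum.inr e) (1 : F)

theorem extKernel_eq (C : NetworkCode G F n) (e : E) :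
    C.extKernel e =
      (if h : G.tail e = G.source then
          ∑ i : Fin n, C.sourceKernel i ⟨e, h⟩ • Pi.single (Sum.inl i) (1 : F)
        else
          ∑ d : G.In (G.tail e), C.kernel (G.tail e) d ⟨e, rfl⟩ • C.extKernel d.1)
      + Pi.single (Sum.inr e) (1 : F) :=
  G.wellFounded_adj.fix_eq _ e

/-- The upper block `F_t` of the decoding matrix at `t`, with rows indexed by the imaginary message
channels. -/
noncomputable def messageMatrix (C : NetworkCode G F n) (t : V) : Matrix (Fin n) (G.In t) F :=
  Matrix.of fun i e => C.extKernel e.1 (Sum.inl i)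

/-- The lower block `G_t` of the decoding matrix at `t`, with rows indexed by the channels. -/
noncomputable def errorMatrix (C : NetworkCode G F n) (t : V) : Matrix E (G.In t) F :=
  Matrix.of fun d e => C.extKernel e.1 (Sum.inr d)

/-- The message space `Φ(t)`, consisting of all `X · F_t`. -/
noncomputable def messageSpace (C : NetworkCode G F n) (t : V) : Submodule F (G.In t → F) :=
  LinearMap.range (C.messageMatrix t).vecMulLinear

/-- The error vectors that match the error pattern `p`. -/
def matching (F : Type*) [Field F] {E : Type*} (p : Finset E) : Submodule F (E → F) where
  carrier := {Z | ∀ e, e ∉ p → Z e = 0}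
  add_mem' := fun {a b} ha hb e he => by
    show a e + b e = 0
    rw [ha e he, hb e he, add_zero]
  zero_mem' := fun _ _ => rfl
  smul_mem' := fun c x hx e he => by
    show c * x e = 0
    rw [hx e he, mul_zero]

/-- The error space `Δ(t, p)` of the error pattern `p`, consisting of all `Z · G_t` with `Z`
matching `p`. -/
noncomputable def errorSpace (C : NetworkCode G F n) (t : V) (p : Finset E) :
    Submodule F (G.In t → F) :=
  (matching F p).map (C.errorMatrix t).vecMulLinear

/-- The error pattern `p` is dominated by the error pattern `q` with respect to `t` if
`Δ(t, p) ⊆ Δ(t, q)` for every `F`-valued linear network code (of any dimension). -/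
def Dominated (G : Network V E) (F : Type*) [Field F] (t : V) (p q : Finset E) : Prop :=
  ∀ (m : ℕ) (C : NetworkCode G F m), C.errorSpace t p ≤ C.errorSpace t q

/-- The rank of the error pattern `p` with respect to `t`: the least size of an error pattern that
dominates `p`. -/
noncomputable def patternRank (G : Network V E) (F : Type*) [Field F] (t : V) (p : Finset E) : ℕ :=
  sInf {k : ℕ | ∃ q : Finset E, Dominated G F t p q ∧ q.card = k}

/-- A code is regular if `dim Φ(t) = n` at every sink `t`. -/
def IsRegular (C : NetworkCode G F n) : Prop :=
  ∀ t ∈ G.sinks, Module.finrank F (C.messageSpace t) = n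

/-- The minimum distance at `t`: the least rank of an error pattern `p` with
`dim (Δ(t, p) ∩ Φ(t)) > 0`. -/
noncomputable def minDist (C : NetworkCode G F n) (t : V) : ℕ :=
  sInf {k : ℕ | ∃ p : Finset E,
    0 < Module.finrank F ↥(C.errorSpace t p ⊓ C.messageSpace t) ∧ patternRank G F t p = k}

/-- A network MDS code is a regular code that attains the refined Singleton bound at every sink:
`d_min = C_t - n + 1` (written without subtraction). -/
def IsMDS (C : NetworkCode G F n) : Prop :=
  C.IsRegular ∧ ∀ t ∈ G.sinks, C.minDist t + n = G.minCut t + 1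

/-- `C 1, …, C ω` is a family of variable-rate network MDS codes: `C n` is an `n`-dimensional
network MDS code, and all of them have the same local encoding kernel at every internal node. -/
def IsVariableRateMDSFamily (ω : ℕ) (C : (n : ℕ) → NetworkCode G F n) : Prop :=
  (∀ n ∈ Finset.Icc 1 ω, (C n).IsMDS) ∧
    ∀ m ∈ Finset.Icc 1 ω, ∀ n ∈ Finset.Icc 1 ω, ∀ v : V, G.IsInternal v →
      (C m).kernel v = (C n).kernel v

end NetworkCode

/-! Call a code separating (`Separates`) if, at each sink t, no nonzero message is received as an
error from an irredundant pattern q with |q| + n ≤ C_t. Every pattern is dominated by an irredundant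
one whose size is its rank, so separating codes are MDS (`Separates.isMDS`). A separating code is
found in dimension ω, and the dimension is then lowered one by one.

Dimension ω (`exists_separates`): a message X confused with an error on q gives a left kernel vector
of a square submatrix of the flow matrix, whose columns are channels outside q. Irredundancy and the
minimum cut yield Hall's condition for matching rows with such channels (`exists_isMatching`). By
acyclicity a matching makes the determinant a nonzero polynomial in the coefficients, and its degree
in each of them is at most one. The field bound then gives a common nonzero of all these
determinants.

From n + 1 to n (`Separates.exists_precode`): the only new patterns have size C_t - n, and for each
of them the confused messages lie on one line (`Separates.exists_line`). The field is large enough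
for a hyperplane of messages containing none of these lines. Restricting to it changes only the
source kernel, so the internal kernels are shared. -/

set_option linter.unusedSectionVars false


/-! ### Encoding kernels in matrix form, and errors seen at a sink -/

namespace Network

/-- In a finite acyclic network the channels can also be ordered from downstream to upstream. -/
theorem wellFounded_adj_swap {V E : Type*} [Finite E] (G : Network V E) :
    WellFounded (fun d e : E => G.head e = G.tail d) := by
  have hirr : Std.Irrefl (fun d e : E =>
      Relation.TransGen (fun d e : E => G.head d = G.tail e) e d) :=
    ⟨fun e h => G.wellFounded_adj.transGen.irrefl.irrefl e h⟩
  have : IsTrans E (fun d e : E =>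
      Relation.TransGen (fun d e : E => G.head d = G.tail e) e d) :=
    ⟨fun _ _ _ h h' => h'.trans h⟩
  have hwf : WellFounded (fun d e : E =>
      Relation.TransGen (fun d e : E => G.head d = G.tail e) e d) :=
    Finite.wellFounded_of_trans_of_irrefl _
  refine Subrelation.wf (r := fun d e : E =>
    Relation.TransGen (fun d e : E => G.head d = G.tail e) e d) ?_ hwf
  intro d e h
  exact Relation.TransGen.single h

end Network

namespace NetworkCode

variable {V E F : Type*} [DecidableEq V] [Fintype E] [DecidableEq E] [Field F]
  {G : Network V E} {n : ℕ}

/-- The local encoding coefficients between real channels, as an `E × E` matrix. -/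
def transfer (C : NetworkCode G F n) : Matrix E E F :=
  Matrix.of fun d e => if h : G.head d = G.tail e then C.kernel (G.tail e) ⟨d, h⟩ ⟨e, rfl⟩ else 0

/-- The local encoding coefficients from imaginary message channels to real channels. -/
def sourceTransfer (C : NetworkCode G F n) : Matrix (Fin n) E F :=
  Matrix.of fun i e => if h : G.tail e = G.source then C.sourceKernel i ⟨e, h⟩ else 0

/-- The message parts of all extended global encoding kernels, as columns of a matrix. -/
noncomputable def globalMessage (C : NetworkCode G F n) : Matrix (Fin n) E F :=
  Matrix.of fun i e => C.extKernel e (Sum.inl i)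

/-- The error parts of all extended global encoding kernels, as columns of a matrix. -/
noncomputable def globalError (C : NetworkCode G F n) : Matrix E E F :=
  Matrix.of fun d e => C.extKernel e (Sum.inr d)

theorem sum_in_kernel (C : NetworkCode G F n) (e : E) (f : E → F) :
    ∑ d : G.In (G.tail e), C.kernel (G.tail e) d ⟨e, rfl⟩ * f d.1 =
      ∑ d, f d * C.transfer d e := by
  rw [← Finset.sum_subset (Finset.filter_subset (fun d => G.head d = G.tail e) Finset.univ),
    Finset.sum_subtype (p := fun d => G.head d = G.tail e) _ (by simp)]
  · refine Finset.sum_congr rfl fun d _ => ?_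
    simp [transfer, d.2, mul_comm]
  · intro d _ hd
    have : ¬ G.head d = G.tail e := by simpa using hd
    simp [transfer, this]

theorem transfer_eq_zero (C : NetworkCode G F n) {d e : E} (h : G.head d ≠ G.tail e) :
    C.transfer d e = 0 := by
  simp [transfer, h]

theorem sourceTransfer_eq_zero (C : NetworkCode G F n) (i : Fin n) {e : E}
    (h : G.tail e ≠ G.source) : C.sourceTransfer i e = 0 := by
  simp [sourceTransfer, h]

theorem transfer_eq_zero_of_source (C : NetworkCode G F n) (d : E) {e : E}
    (h : G.tail e = G.source) : C.transfer d e = 0 :=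
  C.transfer_eq_zero fun h' => G.head_ne_source d (h'.trans h)

theorem globalMessage_eq (C : NetworkCode G F n) :
    C.globalMessage = C.sourceTransfer + C.globalMessage * C.transfer := by
  ext i e
  have h := congrFun (C.extKernel_eq e) (Sum.inl i)
  change C.extKernel e (Sum.inl i) = _
  rw [h]
  by_cases hs : G.tail e = G.source
  · simp [hs, sourceTransfer, Matrix.mul_apply, transfer_eq_zero_of_source, Finset.sum_apply,
      Pi.single_apply]
  · simp [hs, sourceTransfer, Matrix.mul_apply, Finset.sum_apply, globalMessage,
      ← C.sum_in_kernel e fun d => C.extKernel d (Sum.inl i)]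

theorem globalError_eq (C : NetworkCode G F n) :
    C.globalError = 1 + C.globalError * C.transfer := by
  ext d e
  have h := congrFun (C.extKernel_eq e) (Sum.inr d)
  change C.extKernel e (Sum.inr d) = _
  rw [h]
  by_cases hs : G.tail e = G.source
  · simp [hs, Matrix.mul_apply, transfer_eq_zero_of_source, Finset.sum_apply,
      Pi.single_apply, Matrix.one_apply]
  · simp [hs, Matrix.mul_apply, Finset.sum_apply, globalError, Matrix.one_apply, Pi.single_apply,
      ← C.sum_in_kernel e fun d' => C.extKernel d' (Sum.inr d), add_comm]

/-- With K the transfer matrix, the recursion says that the error matrix is a left inverse of 1 - K,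
and a one-sided inverse of a square matrix is two-sided. This turns the upstream recursion into the
downstream one of `globalError_eq'`. -/
theorem one_sub_transfer_mul_globalError (C : NetworkCode G F n) :
    (1 - C.transfer) * C.globalError = 1 := by
  rw [_root_.mul_eq_one_comm, mul_sub, mul_one, sub_eq_iff_eq_add]
  exact C.globalError_eq

theorem globalError_eq' (C : NetworkCode G F n) :
    C.globalError = 1 + C.transfer * C.globalError := by
  have h := C.one_sub_transfer_mul_globalError
  rwa [sub_mul, one_mul, sub_eq_iff_eq_add] at h

theorem globalMessage_eq_mul (C : NetworkCode G F n) :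
    C.globalMessage = C.sourceTransfer * C.globalError := by
  have h : C.globalMessage * (1 - C.transfer) = C.sourceTransfer := by
    rw [Matrix.mul_sub, Matrix.mul_one, sub_eq_iff_eq_add]
    exact C.globalMessage_eq
  rw [← h, Matrix.mul_assoc, one_sub_transfer_mul_globalError, Matrix.mul_one]

/-- The row of the error matrix at `t` that belongs to the channel `d`. -/
noncomputable def errorRow (C : NetworkCode G F n) (t : V) (d : E) : G.In t → F :=
  fun e => C.extKernel e.1 (Sum.inr d)

/-- The row of the message matrix at `t` that belongs to the imaginary message channel `i`. -/
noncomputable def messageRow (C : NetworkCode G F n) (t : V) (i : Fin n) : G.In t → F :=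
  fun e => C.extKernel e.1 (Sum.inl i)

/-- The error space is spanned by the rows of the error matrix that belong to the pattern. -/
theorem errorSpace_eq_span (C : NetworkCode G F n) (t : V) (p : Finset E) :
    C.errorSpace t p = Submodule.span F (C.errorRow t '' p) := by
  apply le_antisymm
  · rintro _ ⟨Z, hZ, rfl⟩
    have : (C.errorMatrix t).vecMulLinear Z = ∑ e, Z e • C.errorRow t e := by
      ext b
      simp [Matrix.vecMul, dotProduct, Finset.sum_apply, errorRow, errorMatrix]
    rw [this]
    refine Submodule.sum_mem _ fun e _ => ?_
    by_cases he : e ∈ p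
    · exact Submodule.smul_mem _ _ (Submodule.subset_span ⟨e, he, rfl⟩)
    · rw [hZ e he, zero_smul]
      exact Submodule.zero_mem _
  · rw [Submodule.span_le]
    rintro _ ⟨e, he, rfl⟩
    refine ⟨Pi.single e 1, fun d hd => Pi.single_eq_of_ne (by rintro rfl; exact hd he) _, ?_⟩
    ext b
    simp [errorRow, errorMatrix]

theorem errorRow_mem (C : NetworkCode G F n) (t : V) {p : Finset E} {e : E} (he : e ∈ p) :
    C.errorRow t e ∈ C.errorSpace t p := by
  rw [errorSpace_eq_span]
  exact Submodule.subset_span ⟨e, he, rfl⟩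

theorem errorSpace_union (C : NetworkCode G F n) (t : V) (p q : Finset E) :
    C.errorSpace t (p ∪ q) = C.errorSpace t p ⊔ C.errorSpace t q := by
  simp [errorSpace_eq_span, Set.image_union, Submodule.span_union]

theorem errorSpace_mono (C : NetworkCode G F n) (t : V) {p q : Finset E} (h : p ⊆ q) :
    C.errorSpace t p ≤ C.errorSpace t q := by
  rw [← Finset.union_eq_right.mpr h, errorSpace_union]
  exact le_sup_left

theorem finrank_errorSpace_le (C : NetworkCode G F n) (t : V) (p : Finset E) :
    Module.finrank F (C.errorSpace t p) ≤ p.card := by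
  classical
  rw [errorSpace_eq_span, ← Finset.coe_image]
  exact (finrank_span_finset_le_card _).trans Finset.card_image_le

/-- An error on a channel that does not enter t reaches t only through the successors of that
channel. -/
theorem errorRow_apply (C : NetworkCode G F n) {t : V} {d : E} (hd : G.head d ≠ t) :
    C.errorRow t d = ∑ e, C.transfer d e • C.errorRow t e := by
  ext b
  have h := congrFun (congrFun C.globalError_eq' d) b.1
  have hdb : d ≠ b.1 := fun h => hd (h ▸ b.2)
  change C.globalError d b.1 = _
  rw [h, Matrix.add_apply, Matrix.one_apply_ne hdb, zero_add, Matrix.mul_apply, Finset.sum_apply]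
  rfl

theorem messageRow_apply (C : NetworkCode G F n) (t : V) (i : Fin n) :
    C.messageRow t i = ∑ e, C.sourceTransfer i e • C.errorRow t e := by
  ext b
  have h := congrFun (congrFun C.globalMessage_eq_mul i) b.1
  change C.globalMessage i b.1 = _
  rw [h, Matrix.mul_apply, Finset.sum_apply]
  rfl

/-- If the channels in `S` do not enter `t` and all their successors lie in `S ∪ q`, then every
error on `S ∪ q` can be imitated at `t` by an error on `q`. -/
theorem errorRow_mem_of_separates (C : NetworkCode G F n) {t : V} {S q : Finset E}
    (hS : ∀ e ∈ S, G.head e ≠ t)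
    (hN : ∀ d ∈ S, ∀ e, G.head d = G.tail e → e ∈ S ∪ q) :
    ∀ e ∈ S ∪ q, C.errorRow t e ∈ C.errorSpace t q := by
  intro e
  induction e using G.wellFounded_adj_swap.induction with
  | _ e ih =>
    intro he
    by_cases heq : e ∈ q
    · exact C.errorRow_mem t heq
    have heS : e ∈ S := (Finset.mem_union.mp he).resolve_right heq
    rw [C.errorRow_apply (hS e heS)]
    refine Submodule.sum_mem _ fun e' _ => ?_
    by_cases h : G.head e = G.tail e'
    · exact Submodule.smul_mem _ _ (ih e' h (hN e heS e' h))
    · rw [C.transfer_eq_zero h, zero_smul]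
      exact Submodule.zero_mem _

/-- The message vector `X · F_t` received at `t`. -/
noncomputable def received (C : NetworkCode G F n) (t : V) : (Fin n → F) →ₗ[F] (G.In t → F) :=
  (C.messageMatrix t).vecMulLinear

theorem received_apply (C : NetworkCode G F n) (t : V) (X : Fin n → F) :
    C.received t X = ∑ i, X i • C.messageRow t i := by
  ext b
  simp [received, Matrix.vecMul, dotProduct, Finset.sum_apply, messageRow, messageMatrix]

/-- Every message vector is also the result of an error on a cut. -/
theorem messageSpace_le_errorSpace (C : NetworkCode G F n) {t : V} {S q : Finset E}
    (hS : ∀ e ∈ S, G.head e ≠ t)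
    (hN : ∀ d ∈ S, ∀ e, G.head d = G.tail e → e ∈ S ∪ q)
    (hs : ∀ e, G.tail e = G.source → e ∈ S ∪ q) :
    C.messageSpace t ≤ C.errorSpace t q := by
  rintro _ ⟨X, rfl⟩
  change C.received t X ∈ _
  rw [received_apply]
  refine Submodule.sum_mem _ fun i _ => Submodule.smul_mem _ _ ?_
  rw [messageRow_apply]
  refine Submodule.sum_mem _ fun e _ => ?_
  by_cases h : G.tail e = G.source
  · exact Submodule.smul_mem _ _ (C.errorRow_mem_of_separates hS hN e (hs e h))
  · rw [C.sourceTransfer_eq_zero i h, zero_smul]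
    exact Submodule.zero_mem _

end NetworkCode

/-! ### Cuts and closed sets of channels -/

namespace Network

variable {V E : Type*} [DecidableEq V] [Fintype E] [DecidableEq E] (G : Network V E)

/-- A set of channels that contains all channels leaving the source, except for those in `S`, and
all channels that follow a channel in `S`, except for those in `S`, is a cut, unless some channel
in `S` enters `t`. -/
theorem isCut_of_closed {t : V} (ht : t ≠ G.source) {S q : Finset E}
    (hS : ∀ e ∈ S, G.head e ≠ t)
    (hN : ∀ d ∈ S, ∀ e, G.head d = G.tail e → e ∈ S ∪ q)
    (hs : ∀ e, G.tail e = G.source → e ∈ S ∪ q) : G.IsCut q G.source t := by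
  have key : ∀ x, Relation.ReflTransGen
      (fun x y : V => ∃ e : E, e ∉ q ∧ G.tail e = x ∧ G.head e = y) G.source x →
      x = G.source ∨ ∃ e ∈ S, G.head e = x := by
    intro x hx
    induction hx with
    | refl => exact Or.inl rfl
    | tail _ h ih =>
      obtain ⟨e, heq, rfl, rfl⟩ := h
      refine Or.inr ⟨e, ?_, rfl⟩
      rcases ih with h | ⟨d, hd, h⟩
      · exact (Finset.mem_union.mp (hs e h)).resolve_right heq
      · exact (Finset.mem_union.mp (hN d hd e h)).resolve_right heq
  intro h
  rcases key t h with h | ⟨e, he, h⟩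
  · exact ht h
  · exact hS e he h

theorem minCut_le_card {t : V} {q : Finset E} (h : G.IsCut q G.source t) :
    G.minCut t ≤ q.card :=
  Nat.sInf_le ⟨q, h, rfl⟩

theorem isCut_in {t : V} (ht : t ≠ G.source) :
    G.IsCut (Finset.univ.filter fun e => G.head e = t) G.source t :=
  G.isCut_of_closed ht (S := Finset.univ.filter fun e => G.head e ≠ t) (by simp)
    (fun _ _ e _ => by simp [em']) (fun e _ => by simp [em'])

theorem exists_isCut_card_eq {t : V} (ht : t ≠ G.source) :
    ∃ q : Finset E, G.IsCut q G.source t ∧ q.card = G.minCut t :=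
  Nat.sInf_mem (s := {n : ℕ | ∃ A : Finset E, G.IsCut A G.source t ∧ A.card = n})
    ⟨_, _, G.isCut_in ht, rfl⟩

/-- The channels on the source side of a cut. -/
theorem exists_closed_of_isCut {t : V} {q : Finset E} (h : G.IsCut q G.source t) :
    ∃ S : Finset E, (∀ e ∈ S, G.head e ≠ t) ∧
      (∀ d ∈ S, ∀ e, G.head d = G.tail e → e ∈ S ∪ q) ∧
      ∀ e, G.tail e = G.source → e ∈ S ∪ q := by
  classical
  set R := Relation.ReflTransGen
      (fun x y : V => ∃ e : E, e ∉ q ∧ G.tail e = x ∧ G.head e = y) G.source with hR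
  refine ⟨Finset.univ.filter fun e => e ∉ q ∧ R (G.tail e), ?_, ?_, ?_⟩
  · intro e he het
    simp only [Finset.mem_filter, Finset.mem_univ, true_and] at he
    exact h (het ▸ he.2.tail ⟨e, he.1, rfl, rfl⟩)
  · intro d hd e hde
    simp only [Finset.mem_filter, Finset.mem_univ, true_and] at hd
    by_cases he : e ∈ q
    · exact Finset.mem_union_right _ he
    · simp only [Finset.mem_union, Finset.mem_filter, Finset.mem_univ, true_and]
      exact Or.inl ⟨he, hde ▸ hd.2.tail ⟨d, hd.1, rfl, rfl⟩⟩
  · intro e hes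
    by_cases he : e ∈ q
    · exact Finset.mem_union_right _ he
    · simp only [Finset.mem_union, Finset.mem_filter, Finset.mem_univ, true_and]
      exact Or.inl ⟨he, hes ▸ Relation.ReflTransGen.refl⟩

theorem sink_ne_source {t : V} (ht : t ∈ G.sinks) : t ≠ G.source :=
  fun h => G.source_notMem_sinks (h ▸ ht)

end Network

/-! ### Irredundant patterns and the separation property -/

namespace NetworkCode

variable {V E F : Type*} [DecidableEq V] [Fintype E] [DecidableEq E] [Field F]
  {G : Network V E} {n : ℕ}

/-- An error pattern that is not dominated by any smaller error pattern. -/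
def IsIrredundant (G : Network V E) (F : Type*) [Field F] (t : V) (p : Finset E) : Prop :=
  ∀ q, Dominated G F t p q → p.card ≤ q.card

theorem isIrredundant_empty (t : V) : IsIrredundant G F t ∅ := fun _ _ => by simp

theorem patternRank_le {t : V} {p q : Finset E} (h : Dominated G F t p q) :
    patternRank G F t p ≤ q.card :=
  Nat.sInf_le ⟨q, h, rfl⟩

theorem exists_dominated_isIrredundant (t : V) (p : Finset E) :
    ∃ q, Dominated G F t p q ∧ q.card = patternRank G F t p ∧ IsIrredundant G F t q := by
  obtain ⟨q, hq, hc⟩ : patternRank G F t p ∈ {k | ∃ q : Finset E, Dominated G F t p q ∧ q.card = k} :=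
    Nat.sInf_mem ⟨_, p, fun _ _ => le_rfl, rfl⟩
  exact ⟨q, hq, hc, fun q' h => hc ▸ patternRank_le fun m C => (hq m C).trans (h m C)⟩

/-- Adding e to a pattern that dominates p without e gives one that dominates p, so a saving for the
smaller pattern would be a saving for p. -/
theorem IsIrredundant.erase {t : V} {p : Finset E} (h : IsIrredundant G F t p) (e : E) :
    IsIrredundant G F t (p.erase e) := by
  intro q hq
  have hd : Dominated G F t p (insert e q) := by
    intro m C
    calc C.errorSpace t p ≤ C.errorSpace t ({e} ∪ p.erase e) :=
          C.errorSpace_mono t fun x hx => by by_cases x = e <;> simp_all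
      _ ≤ C.errorSpace t ({e} ∪ q) := by
          rw [errorSpace_union, errorSpace_union]
          exact sup_le_sup_left (hq m C) _
  have h1 := h _ hd
  have h2 := Finset.card_insert_le e q
  have h3 := Finset.card_erase_le (a := e) (s := p)
  by_cases he : e ∈ p
  · have := Finset.card_erase_add_one he
    omega
  · rw [Finset.erase_eq_of_notMem he]
    by_cases heq : e ∈ q
    · rwa [Finset.insert_eq_of_mem heq] at h1
    · refine h q fun m C => ?_
      simpa [Finset.erase_eq_of_notMem he] using hq m C

/-- No nonzero message is confused with an error on a correctable irredundant pattern. -/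
def Separates (C : NetworkCode G F n) : Prop :=
  ∀ t ∈ G.sinks, ∀ q, IsIrredundant G F t q → q.card + n ≤ G.minCut t →
    ∀ X, C.received t X ∈ C.errorSpace t q → X = 0

/-- Regularity is the case of the empty pattern. The upper bound on the distance comes from C_t - n
+ 1 channels of a minimum cut, the lower bound from replacing a pattern by an irredundant one that
dominates it. -/
theorem Separates.isMDS {C : NetworkCode G F n} (hC : C.Separates) (hn : 1 ≤ n)
    (hcut : ∀ t ∈ G.sinks, n ≤ G.minCut t) : C.IsMDS := by
  have hreg : C.IsRegular := by
    intro t ht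
    have hinj : Function.Injective (C.received t) := by
      rw [← LinearMap.ker_eq_bot, LinearMap.ker_eq_bot']
      intro X hX
      refine hC t ht ∅ (isIrredundant_empty t) (by simpa using hcut t ht) X ?_
      rw [hX]
      exact Submodule.zero_mem _
    exact (LinearMap.finrank_range_of_inj hinj).trans (by simp)
  refine ⟨hreg, fun t ht => ?_⟩
  have hn' := hcut t ht
  obtain ⟨A, hA, hAc⟩ := G.exists_isCut_card_eq (G.sink_ne_source ht)
  obtain ⟨S, hS, hN, hs⟩ := G.exists_closed_of_isCut hA
  obtain ⟨A', hA', hA'c⟩ : ∃ A' ⊆ A, A'.card = G.minCut t - n + 1 :=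
    Finset.exists_subset_card_eq (by omega)
  -- The other n - 1 channels of the cut add at most n - 1 dimensions to the error space of A',
  -- which cannot make room for all n dimensions of the message space.
  have hpos : 0 < Module.finrank F ↥(C.errorSpace t A' ⊓ C.messageSpace t) := by
    have h1 := Submodule.finrank_sup_add_finrank_inf_eq (C.errorSpace t A') (C.messageSpace t)
    have h2 : C.errorSpace t A' ⊔ C.messageSpace t ≤ C.errorSpace t A' ⊔ C.errorSpace t (A \ A') := by
      refine sup_le le_sup_left ?_
      rw [← errorSpace_union, Finset.union_sdiff_of_subset hA']
      exact C.messageSpace_le_errorSpace hS hN hs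
    have h3 := Submodule.finrank_mono h2
    have h4 := Submodule.finrank_add_le_finrank_add_finrank (C.errorSpace t A')
      (C.errorSpace t (A \ A'))
    have h5 := C.finrank_errorSpace_le t (A \ A')
    rw [Finset.card_sdiff_of_subset hA'] at h5
    have h6 := hreg t ht
    omega
  have hmem : patternRank G F t A' ∈ {k : ℕ | ∃ p : Finset E,
      0 < Module.finrank F ↥(C.errorSpace t p ⊓ C.messageSpace t) ∧ patternRank G F t p = k} :=
    ⟨A', hpos, rfl⟩
  have hle : C.minDist t ≤ G.minCut t - n + 1 :=
    (Nat.sInf_le hmem).trans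
      ((patternRank_le (q := A') fun _ _ => le_rfl).trans hA'c.le)
  have hge : G.minCut t - n + 1 ≤ C.minDist t := by
    obtain ⟨p, hp, hpr⟩ : C.minDist t ∈ {k : ℕ | ∃ p : Finset E,
        0 < Module.finrank F ↥(C.errorSpace t p ⊓ C.messageSpace t) ∧ patternRank G F t p = k} :=
      Nat.sInf_mem ⟨_, hmem⟩
    obtain ⟨q, hpq, hqc, hq⟩ := exists_dominated_isIrredundant (G := G) (F := F) t p
    by_contra hlt
    have hbot : C.errorSpace t p ⊓ C.messageSpace t = ⊥ := by
      rw [eq_bot_iff]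
      rintro _ ⟨hx, X, rfl⟩
      have : X = 0 := hC t ht q hq (by omega) X (hpq n C hx)
      rw [this, map_zero]
      exact Submodule.zero_mem _
    rw [hbot, finrank_bot] at hp
    exact absurd hp (lt_irrefl 0)
  omega

/-! ### Matchings from Hall's theorem -/

/-- Two channels `d`, `e` or a message channel `d` and a channel `e` are linked if `d = e` or `e`
leaves the node that `d` enters. -/
def Linked (G : Network V E) : Fin n ⊕ E → E → Prop
  | Sum.inl _, e => G.tail e = G.source
  | Sum.inr d, e => d = e ∨ G.head d = G.tail e

/-- All message channels and all channels that do not enter `t`. -/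
abbrev Row (G : Network V E) (n : ℕ) (t : V) : Type _ := Fin n ⊕ {d : E // G.head d ≠ t}

/-- The inclusion of the rows into all channels. -/
def Row.incl {t : V} : Row G n t → Fin n ⊕ E := Sum.map id Subtype.val

/-- A matching of the rows with channels outside of `q`. -/
structure IsMatching {t : V} (φ : Row G n t → E) (q : Finset E) : Prop where
  injective : Function.Injective φ
  notMem : ∀ r, φ r ∉ q
  linked : ∀ r : Row G n t, Linked G r.incl (φ r)

theorem dominated_of_separates {t : V} {p S q : Finset E}
    (hS : ∀ e ∈ S, G.head e ≠ t)
    (hN : ∀ d ∈ S, ∀ e, G.head d = G.tail e → e ∈ S ∪ q) (hp : p ⊆ S ∪ q) :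
    Dominated G F t p q := by
  intro m C
  rw [C.errorSpace_eq_span t p, Submodule.span_le]
  rintro _ ⟨e, he, rfl⟩
  exact C.errorRow_mem_of_separates hS hN e (hp he)

/-- For a set of rows, let S be its real channels and W the channels linked to it. Without message
rows, (W \ S) ∪ (q \ W) dominates q, and irredundancy gives |W ∩ q| ≤ |W \ S|, that is |S| ≤ |W \
q|. With a message row, W \ S is a cut, hence |W \ S| ≥ |q| + n, which pays for q and all message
rows. -/
theorem exists_isMatching {t : V} (ht : t ∈ G.sinks) {q : Finset E}
    (hq : IsIrredundant G F t q) (hn : q.card + n ≤ G.minCut t) :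
    ∃ φ : Row G n t → E, IsMatching φ q := by
  classical
  suffices h : ∀ s : Finset (Row G n t), s.card ≤
      (s.biUnion fun r => Finset.univ.filter fun e => Linked G r.incl e ∧ e ∉ q).card by
    obtain ⟨φ, hφ, hm⟩ := (Finset.all_card_le_biUnion_card_iff_exists_injective _).mp h
    simp only [Finset.mem_filter, Finset.mem_univ, true_and] at hm
    exact ⟨φ, hφ, fun r => (hm r).2, fun r => (hm r).1⟩
  intro s
  set S : Finset E := s.toRight.map (Function.Embedding.subtype _) with hSdef
  set W : Finset E := Finset.univ.filter fun e => ∃ r ∈ s, Linked G r.incl e with hWdef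
  have hW : (s.biUnion fun r => Finset.univ.filter fun e => Linked G r.incl e ∧ e ∉ q) = W \ q := by
    ext e
    simp [hWdef, ← and_assoc, exists_and_right]
  have hSW : S ⊆ W := by
    intro e he
    simp only [hSdef, Finset.mem_map, Finset.mem_toRight] at he
    obtain ⟨d, hd, rfl⟩ := he
    simp only [hWdef, Finset.mem_filter, Finset.mem_univ, true_and]
    exact ⟨_, hd, Or.inl rfl⟩
  have hS : ∀ e ∈ S, G.head e ≠ t := by
    intro e he
    simp only [hSdef, Finset.mem_map, Finset.mem_toRight] at he
    obtain ⟨d, -, rfl⟩ := he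
    exact d.2
  have hN : ∀ d ∈ S, ∀ e, G.head d = G.tail e → e ∈ W := by
    intro e he e' h
    simp only [hSdef, Finset.mem_map, Finset.mem_toRight] at he
    obtain ⟨d, hd, rfl⟩ := he
    simp only [hWdef, Finset.mem_filter, Finset.mem_univ, true_and]
    exact ⟨_, hd, Or.inr h⟩
  have hs : s.card = s.toLeft.card + S.card := by
    rw [hSdef, Finset.card_map, Finset.card_toLeft_add_card_toRight]
  have hWS : W.card = S.card + (W \ S).card := by
    rw [add_comm, Finset.card_sdiff_add_card_eq_card hSW]
  have hWq : W.card = (W \ q).card + (W ∩ q).card := (Finset.card_sdiff_add_card_inter W q).symm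
  have hq' : q.card = (q \ W).card + (W ∩ q).card := by
    rw [Finset.inter_comm, Finset.card_sdiff_add_card_inter]
  rw [hW, hs]
  rcases s.toLeft.eq_empty_or_nonempty with h0 | ⟨i, hi⟩
  · rw [h0, Finset.card_empty, zero_add]
    have hdom : Dominated G F t q (W \ S ∪ q \ W) := by
      refine dominated_of_separates hS (fun d hd e h => ?_) fun e he => ?_
      · have := hN d hd e h
        simp only [Finset.mem_union, Finset.mem_sdiff]
        tauto
      · simp only [Finset.mem_union, Finset.mem_sdiff]
        tauto
    have := hq _ hdom
    have := Finset.card_union_le (W \ S) (q \ W)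
    omega
  · have hcut : G.IsCut (W \ S) G.source t := by
      refine G.isCut_of_closed (G.sink_ne_source ht) hS (fun d hd e h => ?_) fun e h => ?_
      · rw [Finset.union_sdiff_of_subset hSW]
        exact hN d hd e h
      · rw [Finset.union_sdiff_of_subset hSW]
        simp only [hWdef, Finset.mem_filter, Finset.mem_univ, true_and]
        exact ⟨_, Finset.mem_toLeft.mp hi, h⟩
    have := G.minCut_le_card hcut
    have : s.toLeft.card ≤ n := (Finset.card_le_univ _).trans (by simp)
    have : (W ∩ q).card ≤ q.card := Finset.card_le_card Finset.inter_subset_right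
    omega

/-- A matchable pattern can be enlarged to a matchable pattern of the largest correctable size. -/
theorem IsMatching.exists_superset {t : V} (ht : t ∈ G.sinks) {q : Finset E}
    {φ : Row G n t → E} (hφ : IsMatching φ q) (hn : q.card + n ≤ G.minCut t) :
    ∃ p, q ⊆ p ∧ p.card = G.minCut t - n ∧ IsMatching φ p := by
  classical
  have h1 : q ⊆ Finset.univ \ Finset.univ.image φ := by
    intro e he
    simp only [Finset.mem_sdiff, Finset.mem_univ, true_and, Finset.mem_image, not_exists]
    rintro r rfl
    exact hφ.notMem r he
  -- The matching leaves |In(t)| - n channels unused, and In(t) is itself a cut.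
  have h2 : G.minCut t - n ≤ (Finset.univ \ Finset.univ.image φ).card := by
    rw [Finset.card_sdiff_of_subset (Finset.subset_univ _),
      Finset.card_image_of_injective _ hφ.injective]
    have h3 := G.minCut_le_card (G.isCut_in (G.sink_ne_source ht))
    have h4 : (Finset.univ.filter fun e => G.head e = t).card +
        (Finset.univ.filter fun e => G.head e ≠ t).card = Fintype.card E :=
      Finset.card_filter_add_card_filter_not _
    simp only [Finset.card_univ, Fintype.card_sum, Fintype.card_fin, Fintype.card_subtype]
    omega
  obtain ⟨p, hqp, hp, hpc⟩ := Finset.exists_subsuperset_card_eq h1 (by omega) h2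
  refine ⟨p, hqp, hpc, hφ.injective, fun r hr => ?_, hφ.linked⟩
  simpa using hp hr

end NetworkCode

/-! ### Existence of a separating code of a given dimension -/

/-- Finitely many nonzero polynomials that have degree at most one in each variable have a common
nonzero over any field with more elements than there are polynomials. -/
theorem MvPolynomial.exists_forall_eval_ne_zero {ι σ F : Type*} [Finite σ] [Field F]
    (I : Finset ι) (P : ι → MvPolynomial σ F) (hP : ∀ i ∈ I, P i ≠ 0)
    (hdeg : ∀ i ∈ I, ∀ a, (P i).degreeOf a ≤ 1) (hF : (I.card : ℕ∞) < ENat.card F) :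
    ∃ x : σ → F, ∀ i ∈ I, MvPolynomial.eval x (P i) ≠ 0 := by
  classical
  obtain ⟨S, hS⟩ : ∃ S : Finset F, I.card < S.card := by
    rcases finite_or_infinite F with h | h
    · have := Fintype.ofFinite F
      refine ⟨Finset.univ, ?_⟩
      rw [ENat.card_eq_coe_fintype_card] at hF
      exact_mod_cast hF
    · obtain ⟨S, hS⟩ := Infinite.exists_subset_card_eq F (I.card + 1)
      exact ⟨S, by omega⟩
  by_contra! hcon
  have hprod : ∏ i ∈ I, P i ≠ 0 := Finset.prod_ne_zero_iff.mpr hP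
  refine hprod (MvPolynomial.eq_zero_of_eval_zero_at_prod_finset _ (fun _ => S) (fun a => ?_)
    fun x _ => ?_)
  · refine ((MvPolynomial.degreeOf_prod_le a I P).trans ?_).trans_lt hS
    simpa using Finset.sum_le_card_nsmul I _ 1 fun i hi => hdeg i hi a
  · obtain ⟨i, hi, h⟩ := hcon x
    rw [map_prod]
    exact Finset.prod_eq_zero hi h

namespace NetworkCode

variable {V E F : Type*} [DecidableEq V] [Fintype E] [DecidableEq E] [Field F]
  {G : Network V E} {n : ℕ}

/-- A channel `e` succeeds a message channel or real channel if it leaves the node that the latter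
enters. -/
def Succeeds (G : Network V E) : Fin n ⊕ E → E → Prop
  | Sum.inl _, e => G.tail e = G.source
  | Sum.inr d, e => G.head d = G.tail e

theorem linked_iff (r : Fin n ⊕ E) (e : E) :
    Linked G r e ↔ r = Sum.inr e ∨ Succeeds G r e := by
  cases r <;> simp [Linked, Succeeds]

open Classical in
/-- The difference of the identity and the transfer matrix with coefficients `k`, extended by rows
for the message channels. -/
noncomputable def flowMatrix {R : Type*} [CommRing R] (G : Network V E)
    (k : (Fin n ⊕ E) × E → R) : Matrix (Fin n ⊕ E) E R :=
  Matrix.of fun r e => (if r = Sum.inr e then 1 else 0) - if Succeeds G r e then k (r, e) else 0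

/-- The code with given local encoding coefficients. -/
def ofCoeff (G : Network V E) (k : (Fin n ⊕ E) × E → F) : NetworkCode G F n where
  sourceKernel := Matrix.of fun i e => k (Sum.inl i, e)
  kernel := fun _ => Matrix.of fun d e => k (Sum.inr d, e)

theorem flowMatrix_inl (k : (Fin n ⊕ E) × E → F) (i : Fin n) (e : E) :
    flowMatrix G k (Sum.inl i) e = - (ofCoeff G k).sourceTransfer i e := by
  simp only [flowMatrix, sourceTransfer, ofCoeff, Succeeds, Matrix.of_apply]
  split_ifs <;> simp_all

theorem flowMatrix_inr (k : (Fin n ⊕ E) × E → F) (d e : E) :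
    flowMatrix G k (Sum.inr d) e = (1 - (ofCoeff G k).transfer) d e := by
  simp only [flowMatrix, transfer, ofCoeff, Succeeds, Matrix.of_apply, Matrix.sub_apply,
    Matrix.one_apply, Sum.inr.injEq]
  split_ifs <;> simp_all

/-- The square submatrix of the flow matrix that is selected by `φ`. -/
noncomputable def matchedMatrix {R : Type*} [CommRing R] {t : V} (φ : Row G n t → E)
    (k : (Fin n ⊕ E) × E → R) : Matrix (Row G n t) (Row G n t) R :=
  (flowMatrix G k).submatrix Row.incl φ

theorem Row.incl_injective {t : V} : Function.Injective (Row.incl : Row G n t → Fin n ⊕ E) :=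
  Sum.map_injective.mpr ⟨Function.injective_id, Subtype.val_injective⟩

theorem globalError_mul_one_sub (C : NetworkCode G F n) :
    C.globalError * (1 - C.transfer) = 1 :=
  _root_.mul_eq_one_comm.mp C.one_sub_transfer_mul_globalError

theorem globalMessage_mul_one_sub (C : NetworkCode G F n) :
    C.globalMessage * (1 - C.transfer) = C.sourceTransfer := by
  rw [globalMessage_eq_mul, Matrix.mul_assoc, globalError_mul_one_sub, Matrix.mul_one]

/-- If the matched submatrix is invertible, then no nonzero message is confused with an error. -/
theorem eq_zero_of_received_mem {k : (Fin n ⊕ E) × E → F} {t : V} {φ : Row G n t → E}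
    {p : Finset E} (hφ : ∀ r, φ r ∉ p) (hdet : (matchedMatrix φ k).det ≠ 0) {X : Fin n → F}
    (hX : (ofCoeff G k).received t X ∈ (ofCoeff G k).errorSpace t p) : X = 0 := by
  obtain ⟨Z, hZ, hZX⟩ := hX
  set C := ofCoeff G k with hC
  -- Y is the difference of the two flows on all channels. It vanishes on In(t), and Y(1 - K) equals
  -- the source input of X on the columns outside p, so X and the rest of Y form a left kernel
  -- vector of the matched submatrix.
  set Y : E → F := Matrix.vecMul X C.globalMessage - Matrix.vecMul Z C.globalError with hY
  have hYt : ∀ e, G.head e = t → Y e = 0 := by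
    intro e he
    have := congrFun hZX ⟨e, he⟩
    rw [hY, Pi.sub_apply, sub_eq_zero]
    exact this.symm
  have hYK : Matrix.vecMul Y (1 - C.transfer) = Matrix.vecMul X C.sourceTransfer - Z := by
    rw [hY, Matrix.sub_vecMul, Matrix.vecMul_vecMul, Matrix.vecMul_vecMul,
      globalMessage_mul_one_sub, globalError_mul_one_sub, Matrix.vecMul_one]
  have hv : (Sum.elim X (fun d => Y d.1) : Row G n t → F) = 0 := by
    refine Matrix.eq_zero_of_vecMul_eq_zero hdet ?_
    ext r
    have h1 := congrFun hYK (φ r)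
    rw [Pi.sub_apply, hZ _ (hφ r), sub_zero] at h1
    have h2 : Matrix.vecMul Y (1 - C.transfer) (φ r) =
        ∑ d : {d : E // G.head d ≠ t}, Y d.1 * (1 - C.transfer) d.1 (φ r) := by
      rw [Matrix.vecMul, dotProduct,
        ← Finset.sum_subset (Finset.filter_subset (fun d => G.head d ≠ t) Finset.univ),
        Finset.sum_subtype (p := fun d => G.head d ≠ t) _ (by simp)]
      intro d _ hd
      rw [hYt d (by simpa using hd), zero_mul]
    rw [Matrix.vecMul, dotProduct, Fintype.sum_sum_type]
    simp only [Sum.elim_inl, Sum.elim_inr, matchedMatrix, Matrix.submatrix_apply, Row.incl,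
      Sum.map_inl, Sum.map_inr, flowMatrix_inl, flowMatrix_inr, id, mul_neg,
      Finset.sum_neg_distrib]
    rw [← hC, ← h2, h1]
    simp [Matrix.vecMul, dotProduct]
  ext i
  exact congrFun hv (Sum.inl i)

/-- The variable at (r, e) can occur only in column e, and an injective φ selects that column at
most once; each Leibniz term has one factor per column. -/
theorem degreeOf_det_matchedMatrix_le {t : V} {φ : Row G n t → E} (hφ : Function.Injective φ)
    (a : (Fin n ⊕ E) × E) :
    (matchedMatrix φ (MvPolynomial.X : _ → MvPolynomial ((Fin n ⊕ E) × E) F)).det.degreeOf a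
      ≤ 1 := by
  classical
  have hentry : ∀ r r' : Row G n t,
      (matchedMatrix φ (MvPolynomial.X : _ → MvPolynomial ((Fin n ⊕ E) × E) F) r r').degreeOf a
        ≤ if a = (r.incl, φ r') then 1 else 0 := by
    intro r r'
    simp only [matchedMatrix, flowMatrix, Matrix.submatrix_apply, Matrix.of_apply]
    refine (MvPolynomial.degreeOf_sub_le _ _ _).trans (max_le ?_ ?_)
    · split_ifs <;> simp
    · split_ifs <;> simp_all [MvPolynomial.degreeOf_X]
  rw [Matrix.det_apply]
  refine (MvPolynomial.degreeOf_sum_le _ _ _).trans (Finset.sup_le fun σ _ => ?_)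
  have hsign : ∀ P : MvPolynomial ((Fin n ⊕ E) × E) F,
      (Equiv.Perm.sign σ • P).degreeOf a ≤ P.degreeOf a := by
    intro P
    rcases Int.units_eq_one_or (Equiv.Perm.sign σ) with h | h <;> simp [h]
  refine (hsign _).trans ((MvPolynomial.degreeOf_prod_le _ _ _).trans
    ((Finset.sum_le_sum fun r _ => hentry (σ r) r).trans ?_))
  rw [← Finset.card_filter, Finset.card_le_one]
  intro r hr r' hr'
  simp only [Finset.mem_filter, Finset.mem_univ, true_and] at hr hr'
  exact hφ (congrArg Prod.snd (hr.symm.trans hr'))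

theorem eval_det_matchedMatrix {t : V} (φ : Row G n t → E) (k : (Fin n ⊕ E) × E → F) :
    MvPolynomial.eval k (matchedMatrix φ MvPolynomial.X).det = (matchedMatrix φ k).det := by
  rw [RingHom.map_det]
  congr 1
  ext r r'
  simp only [matchedMatrix, flowMatrix, RingHom.mapMatrix_apply, Matrix.map_apply,
    Matrix.submatrix_apply, Matrix.of_apply, map_sub]
  split_ifs <;> simp

/-- By acyclicity, the unit coefficients along a matching make the matched submatrix
invertible. -/
theorem IsMatching.exists_det_ne_zero {t : V} {φ : Row G n t → E} {p : Finset E}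
    (hφ : IsMatching φ p) : ∃ k : (Fin n ⊕ E) × E → F, (matchedMatrix φ k).det ≠ 0 := by
  classical
  -- The flow matrix carries coefficients with a minus sign, so -1 on matched pairs other than a
  -- channel with itself makes every diagonal entry 1.
  refine ⟨fun a => if ∃ r : Row G n t, r.incl = a.1 ∧ φ r = a.2 ∧ r.incl ≠ Sum.inr (φ r)
    then -1 else 0, ?_⟩
  set k : (Fin n ⊕ E) × E → F := fun a =>
    if ∃ r : Row G n t, r.incl = a.1 ∧ φ r = a.2 ∧ r.incl ≠ Sum.inr (φ r) then -1 else 0 with hk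
  have hdiag : ∀ r, matchedMatrix φ k r r = 1 := by
    intro r
    simp only [matchedMatrix, flowMatrix, Matrix.submatrix_apply, Matrix.of_apply]
    by_cases h : r.incl = Sum.inr (φ r)
    · have hk0 : k (r.incl, φ r) = 0 := by
        rw [hk]
        refine if_neg ?_
        rintro ⟨r', h1, -, h3⟩
        rw [Row.incl_injective h1] at h3
        exact h3 h
      rw [if_pos h, hk0]
      simp
    · have hk1 : k (r.incl, φ r) = -1 := if_pos ⟨r, rfl, rfl, h⟩
      rw [if_neg h, hk1, if_pos (((linked_iff _ _).mp (hφ.linked r)).resolve_left h)]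
      simp
  have hoff : ∀ r r', r ≠ r' → r.incl ≠ Sum.inr (φ r') → matchedMatrix φ k r r' = 0 := by
    intro r r' h h'
    have hk0 : k (r.incl, φ r') = 0 := by
      rw [hk]
      refine if_neg ?_
      rintro ⟨r'', h1, h2, -⟩
      exact h ((Row.incl_injective h1).symm.trans (hφ.injective h2))
    simp only [matchedMatrix, flowMatrix, Matrix.submatrix_apply, Matrix.of_apply]
    rw [if_neg h', hk0]
    simp
  rw [Ne, ← Matrix.exists_mulVec_eq_zero_iff]
  rintro ⟨v, hv, hMv⟩
  -- Off the diagonal, row r can be nonzero only at an r' with φ r' = r. Such an r' is a message row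
  -- or a channel directly upstream of r, so v vanishes by induction from upstream.
  have hstep : ∀ r, (∀ r', r' ≠ r → r.incl = Sum.inr (φ r') → v r' = 0) → v r = 0 := by
    intro r h
    have h1 := congrFun hMv r
    rw [Matrix.mulVec, dotProduct, Finset.sum_eq_single r] at h1
    · simpa [hdiag] using h1
    · intro r' _ hr'
      by_cases h2 : r.incl = Sum.inr (φ r')
      · rw [h r' hr' h2, mul_zero]
      · rw [hoff r r' hr'.symm h2, zero_mul]
    · simp
  have hl : ∀ i, v (Sum.inl i) = 0 := fun i => hstep _ fun r' _ h => by simp [Row.incl] at h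
  have hr : ∀ d, ∀ h : G.head d ≠ t, v (Sum.inr ⟨d, h⟩) = 0 := by
    intro d
    induction d using G.wellFounded_adj.induction with
    | _ d ih =>
      intro hd
      refine hstep _ fun r' hne hr' => ?_
      have hd' : d = φ r' := by simpa [Row.incl] using hr'
      rcases r' with i | ⟨d', h'⟩
      · exact hl i
      · refine ih d' ?_ h'
        have h2 := hφ.linked (Sum.inr ⟨d', h'⟩)
        rw [← hd'] at h2
        rcases h2 with h2 | h2
        · exact absurd (congrArg Sum.inr (Subtype.ext h2)) hne
        · exact h2
  apply hv
  ext r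
  rcases r with i | ⟨d, hd⟩
  · exact hl i
  · exact hr d hd

/-- Smaller patterns are absorbed by enlarging them to matchable ones of size exactly C_t - n, so
one polynomial per such pair (t, p) suffices, and the binomial sum bounds their number. -/
theorem exists_separates (G : Network V E) (n : ℕ)
    (hF : ((∑ t ∈ G.sinks, (Fintype.card E).choose (G.minCut t - n) : ℕ) : ℕ∞) < ENat.card F) :
    ∃ C : NetworkCode G F n, C.Separates := by
  classical
  set I := (G.sinks.sigma fun t => Finset.powersetCard (G.minCut t - n) (Finset.univ : Finset E)).filter
    fun a => ∃ φ : Row G n a.1 → E, IsMatching φ a.2 with hI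
  have hP : ∀ a ∈ I, ∃ P : MvPolynomial ((Fin n ⊕ E) × E) F, P ≠ 0 ∧ (∀ x, P.degreeOf x ≤ 1) ∧
      ∀ k, MvPolynomial.eval k P ≠ 0 → ∀ X : Fin n → F,
        (ofCoeff G k).received a.1 X ∈ (ofCoeff G k).errorSpace a.1 a.2 → X = 0 := by
    intro a ha
    obtain ⟨φ, hφ⟩ := (Finset.mem_filter.mp ha).2
    refine ⟨(matchedMatrix φ MvPolynomial.X).det, ?_, degreeOf_det_matchedMatrix_le hφ.injective,
      fun k hk X hX => eq_zero_of_received_mem hφ.notMem ?_ hX⟩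
    · obtain ⟨k, hk⟩ := hφ.exists_det_ne_zero (F := F)
      intro h
      rw [← eval_det_matchedMatrix, h, map_zero] at hk
      exact hk rfl
    · rwa [eval_det_matchedMatrix] at hk
  choose! P hP0 hPdeg hPk using hP
  have hI' : I.card ≤ ∑ t ∈ G.sinks, (Fintype.card E).choose (G.minCut t - n) := by
    refine (Finset.card_filter_le _ _).trans ?_
    simp [Finset.card_sigma]
  obtain ⟨k, hk⟩ := MvPolynomial.exists_forall_eval_ne_zero I P hP0 hPdeg
    (lt_of_le_of_lt (by exact_mod_cast hI') hF)
  refine ⟨ofCoeff G k, fun t ht q hq hn X hX => ?_⟩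
  obtain ⟨φ, hφ⟩ := exists_isMatching ht hq hn
  obtain ⟨p, hqp, hpc, hp⟩ := hφ.exists_superset ht hn
  have hmem : (⟨t, p⟩ : Σ _ : V, Finset E) ∈ I := by
    rw [hI, Finset.mem_filter, Finset.mem_sigma, Finset.mem_powersetCard]
    exact ⟨⟨ht, Finset.subset_univ _, hpc⟩, φ, hp⟩
  exact hPk _ hmem k (hk _ hmem) X ((ofCoeff G k).errorSpace_mono t hqp hX)

end NetworkCode

/-! ### Lowering the dimension by precoding at the source -/

namespace NetworkCode

variable {V E F : Type*} [DecidableEq V] [Fintype E] [DecidableEq E] [Field F]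
  {G : Network V E} {n : ℕ}

/-- The code of dimension `m` whose source encodes a message by `A` before applying `C`. -/
def precode {m : ℕ} (C : NetworkCode G F n) (A : Matrix (Fin m) (Fin n) F) :
    NetworkCode G F m where
  sourceKernel := A * C.sourceKernel
  kernel := C.kernel

theorem globalError_precode {m : ℕ} (C : NetworkCode G F n) (A : Matrix (Fin m) (Fin n) F) :
    (C.precode A).globalError = C.globalError := by
  have h := C.one_sub_transfer_mul_globalError
  exact (left_inv_eq_right_inv (C.precode A).globalError_mul_one_sub h)

theorem globalMessage_precode {m : ℕ} (C : NetworkCode G F n) (A : Matrix (Fin m) (Fin n) F) :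
    (C.precode A).globalMessage = A * C.globalMessage := by
  have h : (C.precode A).sourceTransfer = A * C.sourceTransfer := by
    ext i e
    by_cases hs : G.tail e = G.source <;>
      simp [sourceTransfer, precode, Matrix.mul_apply, hs]
  rw [globalMessage_eq_mul, globalError_precode, h, Matrix.mul_assoc, ← globalMessage_eq_mul]

theorem errorSpace_precode {m : ℕ} (C : NetworkCode G F n) (A : Matrix (Fin m) (Fin n) F)
    (t : V) (p : Finset E) : (C.precode A).errorSpace t p = C.errorSpace t p := by
  have h : (C.precode A).errorMatrix t = C.errorMatrix t := by
    ext d e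
    exact congrFun (congrFun (C.globalError_precode A) d) e.1
  rw [errorSpace, errorSpace, h]

theorem received_precode {m : ℕ} (C : NetworkCode G F n) (A : Matrix (Fin m) (Fin n) F)
    (t : V) (X : Fin m → F) : (C.precode A).received t X = C.received t (Matrix.vecMul X A) := by
  have h : (C.precode A).messageMatrix t = A * C.messageMatrix t := by
    ext i e
    exact congrFun (congrFun (C.globalMessage_precode A) i) e.1
  simp [received, h, Matrix.vecMul_vecMul]

/-- There is a full-rank matrix whose rows are orthogonal to a given vector. -/
theorem exists_matrix_orthogonal (u : Fin (n + 1) → F) :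
    ∃ A : Matrix (Fin n) (Fin (n + 1)) F,
      (∀ X, Matrix.vecMul X A = 0 → X = 0) ∧ ∀ X, u ⬝ᵥ Matrix.vecMul X A = 0 := by
  set f : (Fin (n + 1) → F) →ₗ[F] F := dotProductBilin F F u with hf
  have hrank : n ≤ Module.finrank F (LinearMap.ker f) := by
    have h1 := f.finrank_range_add_finrank_ker
    have h2 := Submodule.finrank_le (LinearMap.range f)
    simp only [Module.finrank_self, Module.finrank_fin_fun] at h1 h2
    omega
  obtain ⟨b, hb⟩ := exists_linearIndependent_of_le_finrank hrank
  have hcomb : ∀ X : Fin n → F, Matrix.vecMul X (Matrix.of fun i => (b i : Fin (n + 1) → F)) =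
      ((∑ i, X i • b i : LinearMap.ker f) : Fin (n + 1) → F) := by
    intro X
    ext j
    simp [Matrix.vecMul, dotProduct, Finset.sum_apply]
  refine ⟨Matrix.of fun i => (b i : Fin (n + 1) → F), fun X hX => ?_, fun X => ?_⟩
  · rw [hcomb, ZeroMemClass.coe_eq_zero] at hX
    ext i
    exact Fintype.linearIndependent_iff.mp hb X hX i
  · rw [hcomb]
    exact (∑ i, X i • b i : LinearMap.ker f).2

/-- Finitely many nonzero vectors have a common non-orthogonal vector over any field with more
elements than there are vectors. -/
theorem exists_forall_dotProduct_ne_zero {ι σ : Type*} [Fintype σ] (I : Finset ι)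
    (x : ι → σ → F) (hx : ∀ i ∈ I, x i ≠ 0) (hF : (I.card : ℕ∞) < ENat.card F) :
    ∃ u : σ → F, ∀ i ∈ I, u ⬝ᵥ x i ≠ 0 := by
  classical
  set P : ι → MvPolynomial σ F := fun i => ∑ s, MvPolynomial.X s * MvPolynomial.C (x i s) with hPdef
  have heval : ∀ i u, MvPolynomial.eval u (P i) = u ⬝ᵥ x i := by
    intro i u
    simp [hPdef, dotProduct]
  have hP0 : ∀ i ∈ I, P i ≠ 0 := by
    intro i hi h
    refine hx i hi ?_
    ext s
    have := heval i (Pi.single s 1)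
    simpa [h] using this.symm
  have hdeg : ∀ i ∈ I, ∀ a, (P i).degreeOf a ≤ 1 := by
    intro i _ a
    refine (MvPolynomial.degreeOf_sum_le _ _ _).trans (Finset.sup_le fun s _ => ?_)
    refine (MvPolynomial.degreeOf_mul_C_le _ _ _).trans ?_
    rw [MvPolynomial.degreeOf_X]
    split_ifs <;> simp
  obtain ⟨u, hu⟩ := MvPolynomial.exists_forall_eval_ne_zero I P hP0 hdeg hF
  exact ⟨u, fun i hi => heval i u ▸ hu i hi⟩

/-- The messages that are confused with errors on an irredundant pattern that is larger by one than
the correctable ones are multiples of a single message. -/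
theorem Separates.exists_line {C : NetworkCode G F (n + 1)} (hC : C.Separates) {t : V}
    (ht : t ∈ G.sinks) {q : Finset E} (hq : IsIrredundant G F t q)
    (hn : q.card + n = G.minCut t) (hq0 : q.Nonempty) :
    ∃ x : Fin (n + 1) → F, x ≠ 0 ∧
      ∀ X, C.received t X ∈ C.errorSpace t q → ∃ c : F, X = c • x := by
  obtain ⟨e, he⟩ := hq0
  have hcard := Finset.card_erase_add_one he
  -- Without e the pattern is correctable in dimension n + 1, so confusion on q is governed by the
  -- single coefficient of the error row of e.
  have hC' := hC t ht _ (hq.erase e) (by omega)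
  have hmem : ∀ X, C.received t X ∈ C.errorSpace t q →
      ∃ c : F, C.received t X - c • C.errorRow t e ∈ C.errorSpace t (q.erase e) := by
    intro X hX
    have h1 : C.errorSpace t q ≤ C.errorSpace t (q.erase e) ⊔ Submodule.span F {C.errorRow t e} := by
      calc C.errorSpace t q ≤ C.errorSpace t (q.erase e ∪ {e}) :=
            C.errorSpace_mono t fun x hx => by by_cases x = e <;> simp_all
        _ = _ := by
            rw [errorSpace_union, C.errorSpace_eq_span t {e}, Finset.coe_singleton,
              Set.image_singleton]
    obtain ⟨y, hy, z, hz, hyz⟩ := Submodule.mem_sup.mp (h1 hX)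
    obtain ⟨c, rfl⟩ := Submodule.mem_span_singleton.mp hz
    exact ⟨c, by rwa [← hyz, add_sub_cancel_right]⟩
  by_cases h : ∃ x, x ≠ 0 ∧ C.received t x ∈ C.errorSpace t q
  · obtain ⟨x, hx0, hx⟩ := h
    obtain ⟨a, ha⟩ := hmem x hx
    have ha0 : a ≠ 0 := by
      rintro rfl
      exact hx0 (hC' x (by simpa using ha))
    refine ⟨x, hx0, fun X hX => ?_⟩
    obtain ⟨b, hb⟩ := hmem X hX
    -- The factor b / a cancels the contribution of e, leaving a message confused on the correctable
    -- pattern.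
    refine ⟨b / a, sub_eq_zero.mp (hC' _ ?_)⟩
    have h2 := Submodule.sub_mem _ hb (Submodule.smul_mem _ (b / a) ha)
    rw [smul_sub, smul_smul, div_mul_cancel₀ _ ha0, sub_sub_sub_cancel_right] at h2
    rwa [map_sub, map_smul]
  · push Not at h
    -- No nonzero message is confused, so any nonzero vector can serve as x.
    refine ⟨Pi.single 0 1, by simp, fun X hX => ⟨0, ?_⟩⟩
    by_contra hX0
    exact h X (by simpa using hX0) hX

/-- The dimension of a code can be lowered by changing only the source kernel. -/
theorem Separates.exists_precode {C : NetworkCode G F (n + 1)} (hC : C.Separates)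
    (hcut : ∀ t ∈ G.sinks, n + 1 ≤ G.minCut t)
    (hF : ((∑ t ∈ G.sinks, (Fintype.card E).choose (G.minCut t - n) : ℕ) : ℕ∞) < ENat.card F) :
    ∃ A : Matrix (Fin n) (Fin (n + 1)) F, (C.precode A).Separates := by
  classical
  set I := (G.sinks.sigma fun t =>
    Finset.powersetCard (G.minCut t - n) (Finset.univ : Finset E)).filter
      fun a => IsIrredundant G F a.1 a.2 with hI
  have hx : ∀ a ∈ I, ∃ x : Fin (n + 1) → F, x ≠ 0 ∧
      ∀ X, C.received a.1 X ∈ C.errorSpace a.1 a.2 → ∃ c : F, X = c • x := by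
    intro a ha
    rw [hI, Finset.mem_filter, Finset.mem_sigma, Finset.mem_powersetCard] at ha
    obtain ⟨⟨ht, -, hc⟩, hq⟩ := ha
    have := hcut _ ht
    exact hC.exists_line ht hq (by omega) (Finset.card_pos.mp (by omega))
  choose! x hx0 hx using hx
  have hI' : I.card ≤ ∑ t ∈ G.sinks, (Fintype.card E).choose (G.minCut t - n) := by
    refine (Finset.card_filter_le _ _).trans ?_
    simp [Finset.card_sigma]
  obtain ⟨u, hu⟩ := exists_forall_dotProduct_ne_zero I x hx0
    (lt_of_le_of_lt (by exact_mod_cast hI') hF)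
  obtain ⟨A, hA, hAu⟩ := exists_matrix_orthogonal u
  refine ⟨A, fun t ht q hq hn X hX => hA X ?_⟩
  rw [received_precode, errorSpace_precode] at hX
  -- Smaller patterns are handled by the code of dimension n + 1. At the new size the encoded
  -- message is c • x and orthogonal to u, while u is not orthogonal to x, so c = 0.
  rcases Nat.lt_or_ge (q.card + n) (G.minCut t) with hlt | hge
  · exact hC t ht q hq hlt _ hX
  · have hmem : (⟨t, q⟩ : Σ _ : V, Finset E) ∈ I := by
      rw [hI, Finset.mem_filter, Finset.mem_sigma, Finset.mem_powersetCard]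
      have hc : q.card = G.minCut t - n := by omega
      exact ⟨⟨ht, Finset.subset_univ _, hc⟩, hq⟩
    obtain ⟨c, hc⟩ := hx _ hmem _ hX
    have h1 := hAu X
    rw [hc, dotProduct_smul, smul_eq_mul] at h1
    rw [hc, (mul_eq_zero.mp h1).resolve_right (hu _ hmem), zero_smul]

end NetworkCode

/-! ### Assembly of the family -/

theorem mainTheorem3 {V E F : Type*} [Fintype V] [DecidableEq V] [Fintype E] [DecidableEq E]
    [Field F] (G : Network V E) (ω : ℕ)
    (hω : ∀ t ∈ G.sinks, ω ≤ G.minCut t)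
    (hF : (((Finset.Icc 1 ω).sup fun i =>
      ∑ t ∈ G.sinks, (Fintype.card E).choose (G.minCut t - i) : ℕ) : ℕ∞) < ENat.card F) :
    ∃ C : (n : ℕ) → NetworkCode G F n, NetworkCode.IsVariableRateMDSFamily ω C := by
  have hF' : ∀ n ∈ Finset.Icc 1 ω,
      ((∑ t ∈ G.sinks, (Fintype.card E).choose (G.minCut t - n) : ℕ) : ℕ∞) < ENat.card F := by
    intro n hn
    refine lt_of_le_of_lt ?_ hF
    exact_mod_cast Finset.le_sup (f := fun i =>
      ∑ t ∈ G.sinks, (Fintype.card E).choose (G.minCut t - i)) hn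
  -- For ω = 0 the range of dimensions is empty and any codes will do.
  rcases Nat.eq_zero_or_pos ω with rfl | hpos
  · exact ⟨fun _ => ⟨0, fun _ => 0⟩, by simp [NetworkCode.IsVariableRateMDSFamily]⟩
  obtain ⟨C₀, hC₀⟩ := NetworkCode.exists_separates G ω (hF' ω (Finset.mem_Icc.mpr ⟨hpos, le_rfl⟩))
  have hex : ∀ n, n ≤ ω → 1 ≤ n →
      ∃ C : NetworkCode G F n, C.kernel = C₀.kernel ∧ C.Separates := by
    intro n hn
    induction hn using Nat.decreasingInduction with
    | self => exact fun _ => ⟨C₀, rfl, hC₀⟩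
    | of_succ n hn ih =>
      intro h1
      obtain ⟨C, hk, hC⟩ := ih (by omega)
      obtain ⟨A, hA⟩ := hC.exists_precode (fun t ht => le_trans hn (hω t ht))
        (hF' n (Finset.mem_Icc.mpr ⟨h1, hn.le⟩))
      exact ⟨C.precode A, hk, hA⟩
  have hex' : ∀ n, ∃ C : NetworkCode G F n, n ∈ Finset.Icc 1 ω →
      C.kernel = C₀.kernel ∧ C.Separates := by
    intro n
    by_cases hn : n ∈ Finset.Icc 1 ω
    · obtain ⟨C, hC⟩ := hex n (Finset.mem_Icc.mp hn).2 (Finset.mem_Icc.mp hn).1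
      exact ⟨C, fun _ => hC⟩
    · exact ⟨⟨0, fun _ => 0⟩, fun h => absurd h hn⟩
  choose C hC using hex'
  refine ⟨C, fun n hn => ?_, fun m hm n hn v _ => ?_⟩
  · obtain ⟨h1, h2⟩ := Finset.mem_Icc.mp hn
    exact (hC n hn).2.isMDS h1 fun t ht => h2.trans (hω t ht)
  · rw [(hC m hm).1, (hC n hn).1]
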